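/- A Digraph placement game is played on a finite directed graph $G=(V,E)$ (possibly empty) with a not necessarily proper colouring $\phi\colon V\to\{\text{blue},\text{red}\}$. Left and Right move alternately: on her turn Left chooses a blue vertex that has not been deleted and deletes it along with all of its out-neighbours; on his turn Right does the same with a red vertex; a player who cannot move on their turn loses. All games are short normal-play games. Games $Y$ and $Z$ are equal, $Y=Z$, if $X+Y$ and $X+Z$ have the same outcome for every game $X$, where $+$ is the disjunctive sum; the value of a game is the class of all games equal to it. One has $X\le Y$ if Right wins $X-Y$ moving second, and this is a relation on values. The birthday of a game is the greatest length of a sequence of (not necessarily alternating) moves starting in it, and $\mathbb{G}_b$ denotes the set of values born by day $b$, that is, the values of games of birthday at most $b$. For a value $X$ let $f(X)$ be the least number of vertices of a Digraph placement game equal to $X$. For an integer $b\ge 0$ let $$F(b)=\max_{X\in\mathbb{G}_b} f(X),$$ and let $a(b)$ be the largest cardinality of an antichain in $\mathbb{G}_b$, that is, of a subset $S\subseteq\mathbb{G}_b$ such that $X\not\le Y$ and $X\not\ge Y$ for all distinct $X,Y\in S$. Lemma. Let $b\ge 0$. Then the quantities $f(X)$ for $X\in\mathbb{G}_{b+1}$,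 and $F(b)$, $F(b+1)$, $a(b)$, are well defined (the minima and maxima are attained), and $$F(b+1)\le 2\,a(b)\,\bigl(F(b)+b+1\bigr)+5b+8 .$$ -/

import Mathlib

namespace DiPlace

/-- Short partizan games under normal play. A game is given by a finite family of Left options and
a finite family of Right options; being inductively generated, it has no infinite run of play. -/
inductive ShortGame : Type 1
  | mk (α β : Type) [Finite α] [Finite β] (L : α → ShortGame) (R : β → ShortGame) : ShortGame

namespace ShortGame

/-- Recursion on the second summand, used in the definition of the sum: `fL i` and `fR j` are the
functions `Y ↦ L i + Y` and `Y ↦ R j + Y` for the options `L i`, `R j` of the first summand. -/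
def addAux {α β : Type} [Finite α] [Finite β]
    (fL : α → ShortGame → ShortGame) (fR : β → ShortGame → ShortGame) : ShortGame → ShortGame
  | mk γ δ L' R' =>
    mk (α ⊕ γ) (β ⊕ δ)
      (Sum.elim (fun i => fL i (mk γ δ L' R')) (fun k => addAux fL fR (L' k)))
      (Sum.elim (fun j => fR j (mk γ δ L' R')) (fun l => addAux fL fR (R' l)))

/-- The disjunctive sum `X + Y = {X^L + Y, X + Y^L | X^R + Y, X + Y^R}`; the equation itself is
`mk_add_mk`. -/
def add : ShortGame → ShortGame → ShortGame
  | mk _ _ L R => addAux (fun i => add (L i)) (fun j => add (R j))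

instance : Add ShortGame := ⟨add⟩

theorem mk_add_mk {α β γ δ : Type} [Finite α] [Finite β] [Finite γ] [Finite δ]
    (L : α → ShortGame) (R : β → ShortGame) (L' : γ → ShortGame) (R' : δ → ShortGame) :
    mk α β L R + mk γ δ L' R' =
      mk (α ⊕ γ) (β ⊕ δ)
        (Sum.elim (fun i => L i + mk γ δ L' R') (fun k => mk α β L R + L' k))
        (Sum.elim (fun j => R j + mk γ δ L' R') (fun l => mk α β L R + R' l)) := rfl

/-- The negative `-X = {-X^R | -X^L}`. -/
def neg : ShortGame → ShortGame
  | mk α β L R => mk β α (fun j => neg (R j)) (fun i => neg (L i))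

instance : Neg ShortGame := ⟨neg⟩

theorem neg_mk {α β : Type} [Finite α] [Finite β] (L : α → ShortGame) (R : β → ShortGame) :
    -mk α β L R = mk β α (fun j => -R j) (fun i => -L i) := rfl

mutual

/-- Left has a winning strategy when Left moves first. -/
def LeftWinsFirst : ShortGame → Prop
  | mk _ _ L _ => ∃ i, LeftWinsSecond (L i)

/-- Left has a winning strategy when Right moves first. -/
def LeftWinsSecond : ShortGame → Prop
  | mk _ _ _ R => ∀ j, LeftWinsFirst (R j)

end

mutual

/-- Right has a winning strategy when Right moves first. -/
def RightWinsFirst : ShortGame → Prop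
  | mk _ _ _ R => ∃ j, RightWinsSecond (R j)

/-- Right has a winning strategy when Left moves first. -/
def RightWinsSecond : ShortGame → Prop
  | mk _ _ L _ => ∀ i, RightWinsFirst (L i)

end

/-- The four possible outcomes of a game. -/
inductive Outcome : Type
  | leftWin
  | rightWin
  | nextWin
  | previousWin

open Classical in
/-- The outcome of a game: Left win if Left wins moving first or second, Right win if Right wins
moving first or second, next player win if whoever moves first wins, and previous player win
otherwise (that is, if whoever moves first loses). -/
noncomputable def outcome (X : ShortGame) : Outcome :=
  if X.LeftWinsFirst ∧ X.LeftWinsSecond then .leftWin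
  else if X.RightWinsFirst ∧ X.RightWinsSecond then .rightWin
  else if X.LeftWinsFirst ∧ X.RightWinsFirst then .nextWin
  else .previousWin

/-- Equality of games: `Y` and `Z` are equal if `X + Y` and `X + Z` have the same outcome for every
game `X`. -/
def Equal (Y Z : ShortGame) : Prop :=
  ∀ X : ShortGame, (X + Y).outcome = (X + Z).outcome

/-- `X ≤ Y` if Right wins `X - Y` moving second. -/
instance : LE ShortGame := ⟨fun X Y => (X + -Y).RightWinsSecond⟩

instance equalSetoid : Setoid ShortGame where
  r := Equal
  iseqv := ⟨fun _ _ => rfl, fun h X => (h X).symm, fun h h' X => (h X).trans (h' X)⟩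

/-- The birthday of a game: the greatest length of a sequence of moves, by either player in any
order, that starts in the game. -/
noncomputable def birthday : ShortGame → ℕ
  | mk _ _ L R => max (⨆ i, (birthday (L i) + 1)) (⨆ j, (birthday (R j) + 1))

/-! Facts needed for the order on values to be well defined. -/

theorem determined (X : ShortGame) :
    (X.RightWinsSecond ↔ ¬ X.LeftWinsFirst) ∧ (X.LeftWinsSecond ↔ ¬ X.RightWinsFirst) := by
  induction X with
  | mk α β L R ihL ihR =>
    constructor
    · simp only [RightWinsSecond, LeftWinsFirst, not_exists]
      exact forall_congr' fun i => by rw [(ihL i).2, not_not]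
    · simp only [LeftWinsSecond, RightWinsFirst, not_exists]
      exact forall_congr' fun j => by rw [(ihR j).1, not_not]

theorem rightWinsSecond_iff_outcome (X : ShortGame) :
    X.RightWinsSecond ↔ X.outcome = .rightWin ∨ X.outcome = .previousWin := by
  have h1 := X.determined.1
  have h2 := X.determined.2
  unfold outcome
  by_cases a : X.LeftWinsFirst <;> by_cases b : X.RightWinsFirst <;> simp_all

theorem leftWinsSecond_iff_outcome (X : ShortGame) :
    X.LeftWinsSecond ↔ X.outcome = .leftWin ∨ X.outcome = .previousWin := by
  have h1 := X.determined.1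
  have h2 := X.determined.2
  unfold outcome
  by_cases a : X.LeftWinsFirst <;> by_cases b : X.RightWinsFirst <;> simp_all

theorem wins_add_comm (X Y : ShortGame) :
    ((X + Y).LeftWinsFirst ↔ (Y + X).LeftWinsFirst) ∧
      ((X + Y).LeftWinsSecond ↔ (Y + X).LeftWinsSecond) := by
  induction X generalizing Y with
  | mk α β L R ihL ihR =>
    induction Y with
    | mk γ δ L' R' ihL' ihR' =>
      rw [mk_add_mk, mk_add_mk]
      constructor
      · simp only [LeftWinsFirst, Sum.exists, Sum.elim_inl, Sum.elim_inr]
        rw [or_comm]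
        exact or_congr (exists_congr fun k => (ihL' k).2) (exists_congr fun i => (ihL i _).2)
      · simp only [LeftWinsSecond, Sum.forall, Sum.elim_inl, Sum.elim_inr]
        rw [and_comm]
        exact and_congr (forall_congr' fun k => (ihR' k).1) (forall_congr' fun i => (ihR i _).1)

theorem wins_neg (X : ShortGame) :
    ((-X).RightWinsFirst ↔ X.LeftWinsFirst) ∧ ((-X).RightWinsSecond ↔ X.LeftWinsSecond) := by
  induction X with
  | mk α β L R ihL ihR =>
    rw [neg_mk]
    exact ⟨exists_congr fun i => (ihL i).2, forall_congr' fun j => (ihR j).1⟩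

theorem neg_neg' (X : ShortGame) : - -X = X := by
  induction X with
  | mk α β L R ihL ihR =>
    simp only [neg_mk, ihL, ihR]

theorem neg_add' (X Y : ShortGame) : -(X + Y) = -X + -Y := by
  induction X generalizing Y with
  | mk α β L R ihL ihR =>
    induction Y with
    | mk γ δ L' R' ihL' ihR' =>
      simp only [neg_mk, mk_add_mk] at ihL' ihR' ⊢
      congr 1
      · funext j
        rcases j with j | j
        · simp [ihR, neg_mk]
        · exact ihR' j
      · funext i
        rcases i with i | i
        · simp [ihL, neg_mk]
        · exact ihL' i

theorem le_iff (X Y : ShortGame) : X ≤ Y ↔ (X + -Y).RightWinsSecond := Iff.rfl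

/-- `X ≤ Y` also says that Left wins `-X + Y`, hence `Y - X`, moving second. -/
theorem le_iff' (X Y : ShortGame) : X ≤ Y ↔ (-X + Y).LeftWinsSecond := by
  rw [le_iff, ← (wins_neg (-X + Y)).2, neg_add', neg_neg']

theorem le_congr {X X' Y Y' : ShortGame} (hX : Equal X X') (hY : Equal Y Y') :
    X ≤ Y ↔ X' ≤ Y' := by
  have h1 : X ≤ Y ↔ X ≤ Y' := by
    rw [le_iff', le_iff', leftWinsSecond_iff_outcome, leftWinsSecond_iff_outcome, hY (-X)]
  have h2 : X ≤ Y' ↔ X' ≤ Y' := by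
    have key (Z : ShortGame) : Z ≤ Y' ↔ (-Y' + Z).outcome = .rightWin ∨
        (-Y' + Z).outcome = .previousWin := by
      rw [← rightWinsSecond_iff_outcome, le_iff, (determined _).1, (determined _).1,
        (wins_add_comm _ _).1]
    rw [key, key, hX (-Y')]
  exact h1.trans h2

end ShortGame

/-- Game values: classes of equal short games. -/
abbrev Value : Type 1 := Quotient ShortGame.equalSetoid

namespace Value

/-- The order on values, induced from the order on games. -/
instance : LE Value :=
  ⟨Quotient.lift₂ (fun X Y : ShortGame => X ≤ Y)
    fun _ _ _ _ hX hY => propext (ShortGame.le_congr hX hY)⟩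

/-- The set `𝔾_b` of values born by day `b`: the values of the games of birthday at most `b`. -/
def bornBy (b : ℕ) : Set Value :=
  {x | ∃ X : ShortGame, X.birthday ≤ b ∧ (Quotient.mk _ X : Value) = x}

end Value

/-- The two colors. Blue vertices belong to Left and red vertices to Right. -/
inductive Color : Type
  | blue
  | red

/-- A Digraph placement game `(V, E, φ)`: a finite directed graph with a (not necessarily proper)
2-coloring of its vertices. The empty graph is allowed. Loops make no difference to the play, since
a chosen vertex is deleted anyway. -/
structure DigraphPlacement : Type 1 where
  /-- the vertices -/
  V : Type
  [finite : Finite V]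
  /-- the edges -/
  graph : Digraph V
  /-- the coloring -/
  color : V → Color

attribute [instance] DigraphPlacement.finite

namespace DigraphPlacement

variable (G : DigraphPlacement)

/-- The vertices left from `S` after `v` and its out-neighbors have been deleted. -/
def delete (S : Set G.V) (v : G.V) : Set G.V :=
  {u | u ∈ S ∧ u ≠ v ∧ ¬ G.graph.Adj v u}

/-- The game played from the position in which exactly the vertices of `S` have not been deleted:
Left chooses a blue vertex of `S`, Right chooses a red vertex of `S`, and the chosen vertex is
deleted along with its out-neighbors. -/
noncomputable def position (S : Set G.V) : ShortGame :=
  ShortGame.mk {v : G.V // v ∈ S ∧ G.color v = .blue} {v : G.V // v ∈ S ∧ G.color v = .red}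
    (fun v => position (G.delete S v)) (fun v => position (G.delete S v))
termination_by S.ncard
decreasing_by
  all_goals
    refine Set.ncard_lt_ncard (Set.ssubset_iff_subset_ne.2 ⟨fun u hu => hu.1, fun h => ?_⟩)
      (Set.toFinite S)
    exact ((Set.ext_iff.1 h v.1).2 v.2.1).2.1 rfl

/-- The value of the Digraph placement game played on `G`. -/
noncomputable def value : Value := Quotient.mk _ (G.position Set.univ)

/-- The number of vertices. -/
noncomputable def order : ℕ := Nat.card G.V

end DigraphPlacement

/-- The numbers `n` such that some Digraph placement game with exactly `n` vertices is equal to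
`x`. -/
def vertexCounts (x : Value) : Set ℕ :=
  {n | ∃ G : DigraphPlacement, G.value = x ∧ G.order = n}

/-- `f(x)`: the least number of vertices of a Digraph placement game equal to `x`. -/
noncomputable def minVertices (x : Value) : ℕ := sInf (vertexCounts x)

/-- `F(b)`: the maximum of `f` over the values born by day `b`. -/
noncomputable def maxMinVertices (b : ℕ) : ℕ := sSup (minVertices '' Value.bornBy b)

/-- The sizes of the finite antichains of values born by day `b`. -/
def antichainSizes (b : ℕ) : Set ℕ :=
  {n | ∃ S : Finset Value, (S : Set Value) ⊆ Value.bornBy b ∧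
    IsAntichain (· ≤ ·) (S : Set Value) ∧ S.card = n}

/-- `a(b)`: the cardinality of a largest antichain of values born by day `b`. -/
noncomputable def maxAntichain (b : ℕ) : ℕ := sSup (antichainSizes b)

end DiPlace

-- Only undominated options of a game matter: the maximal Left option values and the minimal Right
-- option values form two antichains among values born by day `b`, so at most `2 a(b)` options are
-- needed. Each is realized by a digraph `A i` on at most `F(b)` vertices, and these are glued with
-- one vertex `lead i` each, which deletes everything except the copy of `A i`. Thus the moves at
-- the leads are the wanted options.
--
-- All other opening moves have to be useless. Four keys and four piles of `n` independent
-- monochromatic vertices, `n` at least the birthday of `X`, achieve this (`exists_answer`): any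
-- such move has an answer at an opposing key, after which only a pile of the answering player's
-- color is left. A pile of `n` blue vertices is at least `X`, and one of `n` red vertices is at
-- most `X`, so by `le_of_options` the opening move does not change the value (`value_eq`).
--
-- With `n = b + 1` this costs `2 a(b) (F(b) + 1) + 4 + 4 (b + 1)` vertices, slightly fewer than
-- claimed. The same construction with all options realizes every value, so the minima exist;
-- finiteness of the set of values born by a given day gives the maxima.

namespace DiPlace

-- Options and the order on games

namespace ShortGame

/-- `Z` is a Left option of the game. -/
def LeftOpt : ShortGame → ShortGame → Prop
  | mk _ _ L _, Z => ∃ i, L i = Z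

/-- `Z` is a Right option of the game. -/
def RightOpt : ShortGame → ShortGame → Prop
  | mk _ _ _ R, Z => ∃ j, R j = Z

theorem birthday_mk_le {α β : Type} [Finite α] [Finite β] {L : α → ShortGame} {R : β → ShortGame}
    {n : ℕ} : (mk α β L R).birthday ≤ n ↔
      (∀ i, (L i).birthday + 1 ≤ n) ∧ ∀ j, (R j).birthday + 1 ≤ n := by
  rw [birthday, max_le_iff]
  have key {ι : Type} [Finite ι] (f : ι → ℕ) : (⨆ i, f i) ≤ n ↔ ∀ i, f i ≤ n := by
    rcases isEmpty_or_nonempty ι with h | h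
    · simp
    · exact ciSup_le_iff (Set.finite_range f).bddAbove
  rw [key, key]

theorem birthday_le_iff {X : ShortGame} {n : ℕ} : X.birthday ≤ n ↔
    (∀ Z, X.LeftOpt Z → Z.birthday + 1 ≤ n) ∧ ∀ Z, X.RightOpt Z → Z.birthday + 1 ≤ n := by
  cases X with
  | mk α β L R => simp [birthday_mk_le, LeftOpt, RightOpt]

theorem LeftOpt.birthday_lt {X Z : ShortGame} (h : X.LeftOpt Z) : Z.birthday < X.birthday :=
  (birthday_le_iff.1 le_rfl).1 Z h

theorem RightOpt.birthday_lt {X Z : ShortGame} (h : X.RightOpt Z) : Z.birthday < X.birthday :=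
  (birthday_le_iff.1 le_rfl).2 Z h

theorem leftOpt_add {X Y Z : ShortGame} : (X + Y).LeftOpt Z ↔
    (∃ X', X.LeftOpt X' ∧ X' + Y = Z) ∨ ∃ Y', Y.LeftOpt Y' ∧ X + Y' = Z := by
  cases X; cases Y
  simp [mk_add_mk, LeftOpt]

theorem rightOpt_add {X Y Z : ShortGame} : (X + Y).RightOpt Z ↔
    (∃ X', X.RightOpt X' ∧ X' + Y = Z) ∨ ∃ Y', Y.RightOpt Y' ∧ X + Y' = Z := by
  cases X; cases Y
  simp [mk_add_mk, RightOpt]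

theorem leftOpt_neg {X Z : ShortGame} : (-X).LeftOpt Z ↔ ∃ X', X.RightOpt X' ∧ -X' = Z := by
  cases X
  simp [neg_mk, LeftOpt, RightOpt]

theorem leftWinsFirst_iff {X : ShortGame} :
    X.LeftWinsFirst ↔ ∃ Z, X.LeftOpt Z ∧ Z.LeftWinsSecond := by
  cases X
  simp [LeftWinsFirst, LeftOpt]

theorem leftWinsSecond_iff {X : ShortGame} :
    X.LeftWinsSecond ↔ ∀ Z, X.RightOpt Z → Z.LeftWinsFirst := by
  cases X
  simp [LeftWinsSecond, RightOpt]

theorem rightWinsSecond_iff {X : ShortGame} :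
    X.RightWinsSecond ↔ ∀ Z, X.LeftOpt Z → Z.RightWinsFirst := by
  cases X
  simp [RightWinsSecond, LeftOpt]

theorem not_le_iff_rightWinsFirst {X Y : ShortGame} : ¬ Y ≤ X ↔ (X + -Y).RightWinsFirst := by
  rw [le_iff', (wins_add_comm _ _).2, (determined _).2, not_not]

/-- Left must have no winning opening in `X - Y`; her openings are the Left options of `X` and the
negated Right options of `Y`. Comparisons become recursive here, with no further analysis of play in
sums. -/
theorem le_iff_forall {X Y : ShortGame} : X ≤ Y ↔
    (∀ Z, X.LeftOpt Z → ¬ Y ≤ Z) ∧ ∀ Z, Y.RightOpt Z → ¬ Z ≤ X := by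
  rw [le_iff, rightWinsSecond_iff]
  simp only [not_le_iff_rightWinsFirst, leftOpt_add, leftOpt_neg]
  aesop

theorem not_le_iff_exists {X Y : ShortGame} : ¬ X ≤ Y ↔
    (∃ Z, X.LeftOpt Z ∧ Y ≤ Z) ∨ ∃ Z, Y.RightOpt Z ∧ Z ≤ X := by
  rw [le_iff_forall, not_and_or]
  push Not
  rfl

protected theorem le_refl (X : ShortGame) : X ≤ X := by
  induction X with
  | mk α β L R ihL ihR =>
    rw [le_iff_forall]
    refine ⟨?_, ?_⟩
    · rintro _ ⟨i, rfl⟩ h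
      exact (le_iff_forall.1 h).1 _ ⟨i, rfl⟩ (ihL i)
    · rintro _ ⟨j, rfl⟩ h
      exact (le_iff_forall.1 h).2 _ ⟨j, rfl⟩ (ihR j)

theorem LeftOpt.not_le {X Z : ShortGame} (h : X.LeftOpt Z) : ¬ X ≤ Z :=
  (le_iff_forall.1 X.le_refl).1 Z h

theorem RightOpt.not_le {X Z : ShortGame} (h : X.RightOpt Z) : ¬ Z ≤ X :=
  (le_iff_forall.1 X.le_refl).2 Z h

/-- Left plays `X + Z` by following her strategy for `X + Y` and converting moves through `Y ≤ Z`.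
Each conversion replaces a game by one of its options, so the total birthday drops. This yields both
transitivity and substitution in sums. -/
theorem leftWins_add_mono (n : ℕ) : ∀ X Y Z : ShortGame,
    X.birthday + Y.birthday + Z.birthday < n → Y ≤ Z →
    ((X + Y).LeftWinsSecond → (X + Z).LeftWinsSecond) ∧
      ((X + Y).LeftWinsFirst → (X + Z).LeftWinsFirst) := by
  induction n with
  | zero => intro X Y Z h; omega
  | succ n ih =>
    intro X Y Z hn hYZ
    constructor
    · intro h
      rw [leftWinsSecond_iff] at h ⊢
      intro W hW
      rcases rightOpt_add.1 hW with ⟨X', hX', rfl⟩ | ⟨Z', hZ', rfl⟩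
      · have := hX'.birthday_lt
        exact (ih X' Y Z (by omega) hYZ).2 (h _ (rightOpt_add.2 (.inl ⟨X', hX', rfl⟩)))
      · have hb := hZ'.birthday_lt
        -- Right has moved from `Z` to `Z'`. Either Left replies in `Z'` to something still above
        -- `Y`, or the move corresponds to a Right move in `Y` to something below `Z'`.
        rcases not_le_iff_exists.1 ((le_iff_forall.1 hYZ).2 Z' hZ') with
          ⟨V, hV, hle⟩ | ⟨V, hV, hle⟩
        · have := hV.birthday_lt
          exact leftWinsFirst_iff.2 ⟨X + V, leftOpt_add.2 (.inr ⟨V, hV, rfl⟩),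
            (ih X Y V (by omega) hle).1 (leftWinsSecond_iff.2 h)⟩
        · have := hV.birthday_lt
          exact (ih X V Z' (by omega) hle).2 (h _ (rightOpt_add.2 (.inr ⟨V, hV, rfl⟩)))
    · intro h
      obtain ⟨W, hW, hwin⟩ := leftWinsFirst_iff.1 h
      rcases leftOpt_add.1 hW with ⟨X', hX', rfl⟩ | ⟨Y', hY', rfl⟩
      · have := hX'.birthday_lt
        exact leftWinsFirst_iff.2 ⟨X' + Z, leftOpt_add.2 (.inl ⟨X', hX', rfl⟩),
          (ih X' Y Z (by omega) hYZ).1 hwin⟩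
      · have hb := hY'.birthday_lt
        rcases not_le_iff_exists.1 ((le_iff_forall.1 hYZ).1 Y' hY') with
          ⟨V, hV, hle⟩ | ⟨V, hV, hle⟩
        · have := hV.birthday_lt
          exact leftWinsFirst_iff.2 ⟨X + V, leftOpt_add.2 (.inr ⟨V, hV, rfl⟩),
            (ih X Y' V (by omega) hle).1 hwin⟩
        · have := hV.birthday_lt
          exact (ih X V Z (by omega) hle).2
            (leftWinsSecond_iff.1 hwin _ (rightOpt_add.2 (.inr ⟨V, hV, rfl⟩)))

protected theorem le_trans {X Y Z : ShortGame} (hXY : X ≤ Y) (hYZ : Y ≤ Z) : X ≤ Z :=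
  (le_iff' X Z).2 ((leftWins_add_mono _ (-X) Y Z (Nat.lt_succ_self _) hYZ).1 ((le_iff' X Y).1 hXY))

theorem outcome_congr {X Y : ShortGame} (h1 : X.LeftWinsFirst ↔ Y.LeftWinsFirst)
    (h2 : X.LeftWinsSecond ↔ Y.LeftWinsSecond) : X.outcome = Y.outcome := by
  have h3 : X.RightWinsSecond ↔ Y.RightWinsSecond := by
    rw [(determined X).1, (determined Y).1, h1]
  have h4 : X.RightWinsFirst ↔ Y.RightWinsFirst := by
    rw [← not_iff_not, ← (determined X).2, ← (determined Y).2, h2]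
  unfold outcome
  rw [propext h1, propext h2, propext h3, propext h4]

/-- Monotonicity in both directions fixes when Left wins; determinacy then fixes the whole outcome.
-/
theorem equal_iff {X Y : ShortGame} : Equal X Y ↔ X ≤ Y ∧ Y ≤ X := by
  constructor
  · intro h
    exact ⟨(le_congr (fun _ => rfl) h).1 X.le_refl, (le_congr h (fun _ => rfl)).1 X.le_refl⟩
  · rintro ⟨h1, h2⟩ Z
    have m1 := leftWins_add_mono _ Z X Y (Nat.lt_succ_self _) h1
    have m2 := leftWins_add_mono _ Z Y X (Nat.lt_succ_self _) h2
    have s : (Z + X).LeftWinsSecond ↔ (Z + Y).LeftWinsSecond := ⟨m1.1, m2.1⟩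
    have f : (Z + X).LeftWinsFirst ↔ (Z + Y).LeftWinsFirst := ⟨m1.2, m2.2⟩
    exact outcome_congr f s

/-- A sufficient condition for `X ≤ Y`: Left options of `X` are dominated by Left options of `Y` or
reversed by a Right option that is at most `Y`, and so on. -/
theorem le_of_options {X Y : ShortGame}
    (hL : ∀ Z, X.LeftOpt Z → (∃ W, Y.LeftOpt W ∧ Z ≤ W) ∨ ∃ W, Z.RightOpt W ∧ W ≤ Y)
    (hR : ∀ Z, Y.RightOpt Z → (∃ W, X.RightOpt W ∧ W ≤ Z) ∨ ∃ W, Z.LeftOpt W ∧ X ≤ W) :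
    X ≤ Y := by
  rw [le_iff_forall]
  refine ⟨fun Z hZ h => ?_, fun Z hZ h => ?_⟩
  · rcases hL Z hZ with ⟨W, hW, hle⟩ | ⟨W, hW, hle⟩
    · exact hW.not_le (ShortGame.le_trans h hle)
    · exact hW.not_le (ShortGame.le_trans hle h)
  · rcases hR Z hZ with ⟨W, hW, hle⟩ | ⟨W, hW, hle⟩
    · exact hW.not_le (ShortGame.le_trans hle h)
    · exact hW.not_le (ShortGame.le_trans h hle)

end ShortGame

-- Values: partial order and finiteness by day

namespace Value

theorem mk_eq_mk {X Y : ShortGame} :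
    (Quotient.mk _ X : Value) = Quotient.mk _ Y ↔ X ≤ Y ∧ Y ≤ X :=
  Quotient.eq.trans ShortGame.equal_iff

instance partialOrder : PartialOrder Value where
  lt x y := x ≤ y ∧ ¬ y ≤ x
  lt_iff_le_not_ge _ _ := Iff.rfl
  le_refl x := by
    induction x using Quotient.inductionOn with
    | h X => exact X.le_refl
  le_trans x y z := by
    induction x using Quotient.inductionOn
    induction y using Quotient.inductionOn
    induction z using Quotient.inductionOn
    exact ShortGame.le_trans
  le_antisymm x y := by
    induction x using Quotient.inductionOn
    induction y using Quotient.inductionOn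
    exact fun h1 h2 => mk_eq_mk.2 ⟨h1, h2⟩

/-- Declared so that it is preferred to the order that Mathlib puts on quotients. -/
instance preorder : Preorder Value := partialOrder.toPreorder

/-- The values of the Left options of a game. -/
def leftValues (X : ShortGame) : Set Value := Quotient.mk _ '' {Z | X.LeftOpt Z}

/-- The values of the Right options of a game. -/
def rightValues (X : ShortGame) : Set Value := Quotient.mk _ '' {Z | X.RightOpt Z}

theorem finite_leftValues (X : ShortGame) : (leftValues X).Finite := by
  cases X with
  | mk α β L R => exact (Set.finite_range L).image _

theorem finite_rightValues (X : ShortGame) : (rightValues X).Finite := by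
  cases X with
  | mk α β L R => exact (Set.finite_range R).image _

theorem leftValues_subset {X : ShortGame} {b : ℕ} (h : X.birthday ≤ b + 1) :
    leftValues X ⊆ bornBy b := by
  rintro _ ⟨Z, hZ, rfl⟩
  exact ⟨Z, Nat.le_of_lt_succ (hZ.birthday_lt.trans_le h), rfl⟩

theorem rightValues_subset {X : ShortGame} {b : ℕ} (h : X.birthday ≤ b + 1) :
    rightValues X ⊆ bornBy b := by
  rintro _ ⟨Z, hZ, rfl⟩
  exact ⟨Z, Nat.le_of_lt_succ (hZ.birthday_lt.trans_le h), rfl⟩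

theorem mk_le_mk_of_values_eq {X Y : ShortGame} (hL : leftValues X = leftValues Y)
    (hR : rightValues X = rightValues Y) : X ≤ Y := by
  refine ShortGame.le_of_options (fun Z hZ => .inl ?_) (fun Z hZ => .inl ?_)
  · obtain ⟨W, hW, h⟩ := hL.subset ⟨Z, hZ, rfl⟩
    exact ⟨W, hW, (mk_eq_mk.1 h).2⟩
  · obtain ⟨W, hW, h⟩ := hR.symm.subset ⟨Z, hZ, rfl⟩
    exact ⟨W, hW, (mk_eq_mk.1 h).1⟩

theorem mk_out (x : Value) : (Quotient.mk _ x.out : Value) = x := Quotient.out_eq x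

theorem bornBy_nonempty (b : ℕ) : (bornBy b).Nonempty :=
  ⟨_, ShortGame.mk Empty Empty Empty.elim Empty.elim,
    ShortGame.birthday_mk_le.2 ⟨fun i => i.elim, fun j => j.elim⟩, rfl⟩

/-- A value is determined by the sets of option values of any representative, so the values in
question inject into pairs of subsets of `S`. -/
theorem finite_bornBy_of_options {b : ℕ} {S : Set Value} (hS : S.Finite)
    (h : ∀ X : ShortGame, X.birthday ≤ b → leftValues X ⊆ S ∧ rightValues X ⊆ S) :
    (bornBy b).Finite := by
  have : Nonempty ShortGame := ⟨(Value.bornBy_nonempty b).some.out⟩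
  choose! rep hrep using fun x (hx : x ∈ bornBy b) => hx
  refine Set.Finite.of_injOn (f := fun x => (leftValues (rep x), rightValues (rep x)))
    (t := S.powerset ×ˢ S.powerset) (fun x hx => h _ (hrep x hx).1) ?_
    (hS.finite_subsets.prod hS.finite_subsets)
  intro x hx y hy hxy
  obtain ⟨hL, hR⟩ := Prod.mk.inj hxy
  rw [← (hrep x hx).2, ← (hrep y hy).2]
  exact mk_eq_mk.2 ⟨mk_le_mk_of_values_eq hL hR, mk_le_mk_of_values_eq hL.symm hR.symm⟩

theorem finite_bornBy (b : ℕ) : (bornBy b).Finite := by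
  induction b with
  | zero =>
    refine finite_bornBy_of_options Set.finite_empty fun X hX => ⟨?_, ?_⟩
    · rintro _ ⟨Z, hZ, -⟩
      exact absurd (hZ.birthday_lt.trans_le hX) (Nat.not_lt_zero _)
    · rintro _ ⟨Z, hZ, -⟩
      exact absurd (hZ.birthday_lt.trans_le hX) (Nat.not_lt_zero _)
  | succ b ih =>
    exact finite_bornBy_of_options ih fun X hX => ⟨leftValues_subset hX, rightValues_subset hX⟩

end Value

-- Colors, independent monochromatic positions and embeddings

/-- The other color. -/
def Color.opp : Color → Color
  | .blue => .red
  | .red => .blue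

theorem Color.opp_ne (c : Color) : c.opp ≠ c := by cases c <;> exact Color.noConfusion

/-- Colors correspond to truth values. -/
def Color.equivBool : Color ≃ Bool where
  toFun | .blue => true | .red => false
  invFun | true => .blue | false => .red
  left_inv c := by cases c <;> rfl
  right_inv t := by cases t <;> rfl

instance : Finite Color := Finite.of_equiv _ Color.equivBool.symm

namespace DigraphPlacement

variable {G H : DigraphPlacement}

theorem leftOpt_position {S : Set G.V} {Z : ShortGame} : (G.position S).LeftOpt Z ↔
    ∃ v ∈ S, G.color v = .blue ∧ G.position (G.delete S v) = Z := by
  rw [position]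
  simp [ShortGame.LeftOpt, and_assoc]

theorem rightOpt_position {S : Set G.V} {Z : ShortGame} : (G.position S).RightOpt Z ↔
    ∃ v ∈ S, G.color v = .red ∧ G.position (G.delete S v) = Z := by
  rw [position]
  simp [ShortGame.RightOpt, and_assoc]

theorem ncard_delete_lt {S : Set G.V} {v : G.V} (hv : v ∈ S) :
    (G.delete S v).ncard < S.ncard := by
  refine Set.ncard_lt_ncard (Set.ssubset_iff_subset_ne.2 ⟨fun u hu => hu.1, fun h => ?_⟩)
    (Set.toFinite S)
  exact (h.symm.subset hv).2.1 rfl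

theorem delete_eq_diff {S : Set G.V} (hS : ∀ u ∈ S, ∀ v ∈ S, ¬ G.graph.Adj u v) {v : G.V}
    (hv : v ∈ S) : G.delete S v = S \ {v} := by
  ext u
  simp only [delete, Set.mem_ofPred_eq, Set.mem_sdiff, Set.mem_singleton_iff]
  exact ⟨fun h => ⟨h.1, h.2.1⟩, fun h => ⟨h.1, h.2, hS v hv u h.1⟩⟩

/-- Enough independent blue vertices are at least as good for Left as a game of small birthday. -/
theorem le_position_of_blue (n : ℕ) : ∀ (X : ShortGame) (S : Set G.V), X.birthday ≤ n →
    n ≤ S.ncard → (∀ v ∈ S, G.color v = .blue) → (∀ u ∈ S, ∀ v ∈ S, ¬ G.graph.Adj u v) →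
    X ≤ G.position S := by
  induction n with
  | zero =>
    intro X S hX _ hc _
    refine ShortGame.le_of_options (fun Z hZ => ?_) (fun Z hZ => ?_)
    · exact absurd (hZ.birthday_lt.trans_le hX) (Nat.not_lt_zero _)
    · obtain ⟨v, hv, hred, -⟩ := rightOpt_position.1 hZ
      exact absurd ((hc v hv).symm.trans hred) Color.noConfusion
  | succ n ih =>
    intro X S hX hn hc ha
    refine ShortGame.le_of_options (fun Z hZ => .inl ?_) (fun Z hZ => ?_)
    -- Any vertex serves as the reply: by independence the move costs just that vertex, so the size
    -- falls by one along with the birthday bound.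
    · obtain ⟨v, hv⟩ := Set.nonempty_of_ncard_ne_zero (by omega : S.ncard ≠ 0)
      refine ⟨_, leftOpt_position.2 ⟨v, hv, hc v hv, rfl⟩, ?_⟩
      rw [delete_eq_diff ha hv]
      exact ih Z _ (Nat.le_of_lt_succ (hZ.birthday_lt.trans_le hX))
        (by rw [Set.ncard_sdiff_singleton_of_mem hv]; omega) (fun u hu => hc u hu.1)
        (fun u hu w hw => ha u hu.1 w hw.1)
    · obtain ⟨v, hv, hred, -⟩ := rightOpt_position.1 hZ
      exact absurd ((hc v hv).symm.trans hred) Color.noConfusion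

/-- Enough independent red vertices are at least as good for Right as a game of small birthday. -/
theorem position_le_of_red (n : ℕ) : ∀ (X : ShortGame) (S : Set G.V), X.birthday ≤ n →
    n ≤ S.ncard → (∀ v ∈ S, G.color v = .red) → (∀ u ∈ S, ∀ v ∈ S, ¬ G.graph.Adj u v) →
    G.position S ≤ X := by
  induction n with
  | zero =>
    intro X S hX _ hc _
    refine ShortGame.le_of_options (fun Z hZ => ?_) (fun Z hZ => ?_)
    · obtain ⟨v, hv, hblue, -⟩ := leftOpt_position.1 hZ
      exact absurd ((hc v hv).symm.trans hblue) Color.noConfusion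
    · exact absurd (hZ.birthday_lt.trans_le hX) (Nat.not_lt_zero _)
  | succ n ih =>
    intro X S hX hn hc ha
    refine ShortGame.le_of_options (fun Z hZ => ?_) (fun Z hZ => .inl ?_)
    · obtain ⟨v, hv, hblue, -⟩ := leftOpt_position.1 hZ
      exact absurd ((hc v hv).symm.trans hblue) Color.noConfusion
    · obtain ⟨v, hv⟩ := Set.nonempty_of_ncard_ne_zero (by omega : S.ncard ≠ 0)
      refine ⟨_, rightOpt_position.2 ⟨v, hv, hc v hv, rfl⟩, ?_⟩
      rw [delete_eq_diff ha hv]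
      exact ih Z _ (Nat.le_of_lt_succ (hZ.birthday_lt.trans_le hX))
        (by rw [Set.ncard_sdiff_singleton_of_mem hv]; omega) (fun u hu => hc u hu.1)
        (fun u hu w hw => ha u hu.1 w hw.1)

theorem delete_image {f : G.V → H.V} (hf : f.Injective)
    (hadj : ∀ u v, H.graph.Adj (f u) (f v) ↔ G.graph.Adj u v) (S : Set G.V) (v : G.V) :
    H.delete (f '' S) (f v) = f '' G.delete S v := by
  ext u
  constructor
  · rintro ⟨⟨w, hw, rfl⟩, hne, hna⟩
    exact ⟨w, ⟨hw, fun h => hne (congrArg f h), fun h => hna ((hadj v w).2 h)⟩, rfl⟩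
  · rintro ⟨w, ⟨hw, hne, hna⟩, rfl⟩
    exact ⟨⟨w, hw, rfl⟩, fun h => hne (hf h), fun h => hna ((hadj v w).1 h)⟩

/-- A position is equal to its image under an embedding of colored digraphs. -/
theorem position_image {f : G.V → H.V} (hf : f.Injective)
    (hadj : ∀ u v, H.graph.Adj (f u) (f v) ↔ G.graph.Adj u v)
    (hcol : ∀ v, H.color (f v) = G.color v) (n : ℕ) : ∀ S : Set G.V, S.ncard < n →
    H.position (f '' S) ≤ G.position S ∧ G.position S ≤ H.position (f '' S) := by
  induction n with
  | zero => intro S h; omega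
  | succ n ih =>
    intro S hS
    have ih' (v) (hv : v ∈ S) : H.position (H.delete (f '' S) (f v)) ≤ G.position (G.delete S v) ∧
        G.position (G.delete S v) ≤ H.position (H.delete (f '' S) (f v)) := by
      rw [delete_image hf hadj]
      exact ih _ (Nat.lt_of_lt_of_le (ncard_delete_lt hv) (Nat.le_of_lt_succ hS))
    constructor <;> refine ShortGame.le_of_options (fun Z hZ => .inl ?_) (fun Z hZ => .inl ?_)
    · obtain ⟨_, ⟨v, hv, rfl⟩, hc, rfl⟩ := leftOpt_position.1 hZ
      exact ⟨_, leftOpt_position.2 ⟨v, hv, (hcol v).symm.trans hc, rfl⟩, (ih' v hv).1⟩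
    · obtain ⟨v, hv, hc, rfl⟩ := rightOpt_position.1 hZ
      exact ⟨_, rightOpt_position.2 ⟨f v, ⟨v, hv, rfl⟩, (hcol v).trans hc, rfl⟩, (ih' v hv).1⟩
    · obtain ⟨v, hv, hc, rfl⟩ := leftOpt_position.1 hZ
      exact ⟨_, leftOpt_position.2 ⟨f v, ⟨v, hv, rfl⟩, (hcol v).trans hc, rfl⟩, (ih' v hv).2⟩
    · obtain ⟨_, ⟨v, hv, rfl⟩, hc, rfl⟩ := rightOpt_position.1 hZ
      exact ⟨_, rightOpt_position.2 ⟨v, hv, (hcol v).symm.trans hc, rfl⟩, (ih' v hv).2⟩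

end DigraphPlacement

-- The gadget construction

/-- The vertices of the digraph that realizes a game with options realized by `A i`: a copy of each
`A i`, a vertex `lead i` for the move to `A i`, and a gadget of keys and piles that makes all moves
other than those to the `A i` losing. -/
inductive GadgetVertex (I : Type) (A : I → DigraphPlacement) (n : ℕ) : Type
  | opt (i : I) (x : (A i).V)
  | lead (i : I)
  | key (c : Color) (t : Bool)
  | pile (c : Color) (t : Bool) (k : Fin n)

namespace GadgetVertex

variable {I : Type} {A : I → DigraphPlacement} {n : ℕ}

/-- The gadget vertices as a disjoint union. -/
def equivSum : GadgetVertex I A n ≃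
    ((Σ i, (A i).V) ⊕ I) ⊕ ((Color × Bool) ⊕ (Color × Bool × Fin n)) where
  toFun
    | opt i x => .inl (.inl ⟨i, x⟩)
    | lead i => .inl (.inr i)
    | key c t => .inr (.inl (c, t))
    | pile c t k => .inr (.inr (c, t, k))
  invFun
    | .inl (.inl ⟨i, x⟩) => opt i x
    | .inl (.inr i) => lead i
    | .inr (.inl (c, t)) => key c t
    | .inr (.inr (c, t, k)) => pile c t k
  left_inv v := by cases v <;> rfl
  right_inv v := by rcases v with (⟨i, x⟩ | i) | (⟨c, t⟩ | ⟨c, t, k⟩) <;> rfl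

instance [Finite I] : Finite (GadgetVertex I A n) := Finite.of_equiv _ equivSum.symm

theorem card_eq [Finite I] : Nat.card (GadgetVertex I A n) =
    Nat.card (Σ i, (A i).V) + Nat.card I + (4 + 4 * n) := by
  have hc : Nat.card Color = 2 := by
    rw [Nat.card_congr Color.equivBool, Nat.card_eq_fintype_card, Fintype.card_bool]
  rw [Nat.card_congr equivSum, Nat.card_sum, Nat.card_sum, Nat.card_sum, Nat.card_prod,
    Nat.card_prod, Nat.card_prod, hc]
  simp
  ring

theorem ncard_range_pile (c : Color) (t : Bool) :
    (Set.range (pile c t : Fin n → GadgetVertex I A n)).ncard = n := by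
  rw [← Set.image_univ, Set.ncard_image_of_injective, Set.ncard_univ, Nat.card_fin]
  intro k l h
  injection h

/-- `partner c t` is the index of the key that answers the key of color `c` and index `t`. -/
def partner : Color → Bool → Bool
  | .red, t => t
  | .blue, t => !t

/-- The color of a gadget vertex, given the colors of the vertices `lead i`. -/
def color (side : I → Color) : GadgetVertex I A n → Color
  | opt i x => (A i).color x
  | lead i => side i
  | key c _ => c
  | pile c _ _ => c

/-- Adjacency of gadget vertices. -/
def Adj : GadgetVertex I A n → GadgetVertex I A n → Prop
  | opt i x, opt j y => ∃ h : i = j, (A j).graph.Adj (h ▸ x) y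
  | opt i x, key d _ => (A i).color x = d
  | opt i x, pile d _ _ => (A i).color x = d
  | opt _ _, lead _ => False
  | lead i, opt j _ => i ≠ j
  | lead _, _ => True
  | key c t, key d s => ¬ (d = c.opp ∧ s = partner c t)
  | key c t, pile d s _ => ¬ (d = c ∧ s = t ∨ d = c.opp ∧ s = partner c t)
  | key _ _, _ => True
  | pile c _ _, key d _ => d = c
  | pile c t _, pile d s _ => d = c ∧ s = !t
  | pile _ _ _, _ => False

end GadgetVertex

/-- The digraph built from the `A i` and the gadget. -/
def gadgetGraph (I : Type) [Finite I] (side : I → Color) (A : I → DigraphPlacement) (n : ℕ) :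
    DigraphPlacement where
  V := GadgetVertex I A n
  graph := ⟨GadgetVertex.Adj⟩
  color := GadgetVertex.color side

namespace gadgetGraph

open GadgetVertex

variable {I : Type} [Finite I] {side : I → Color} {A : I → DigraphPlacement} {n : ℕ}

theorem delete_univ_lead (i : I) :
    (gadgetGraph I side A n).delete Set.univ (lead i) = opt i '' Set.univ := by
  ext u
  change (True ∧ u ≠ lead i ∧ ¬ GadgetVertex.Adj (lead i) u) ↔ _
  constructor
  · rintro ⟨-, hne, hna⟩
    cases u with
    | opt j x =>
      obtain rfl : i = j := not_not.1 hna
      exact ⟨x, trivial, rfl⟩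
    | lead j => exact absurd trivial hna
    | key c t => exact absurd trivial hna
    | pile c t k => exact absurd trivial hna
  · rintro ⟨x, -, rfl⟩
    exact ⟨trivial, (fun h => by injection h : opt i x ≠ lead i), fun h => h rfl⟩

theorem position_lead (i : I) :
    (gadgetGraph I side A n).position ((gadgetGraph I side A n).delete Set.univ (lead i)) ≤
        (A i).position Set.univ ∧ (A i).position Set.univ ≤
      (gadgetGraph I side A n).position ((gadgetGraph I side A n).delete Set.univ (lead i)) := by
  rw [delete_univ_lead]
  refine DigraphPlacement.position_image (H := gadgetGraph I side A n) (f := opt i) ?_ ?_ ?_ _ _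
    (Nat.lt_succ_self _)
  · intro x y h
    injection h
  · intro u v
    exact ⟨fun ⟨_, h⟩ => h, fun h => ⟨rfl, h⟩⟩
  · intro v
    rfl

/-- Every first move other than a `lead` has an answer that leaves only a pile of the color of the
answering player. -/
theorem exists_answer (u : GadgetVertex I A n) (hu : ∀ i, u ≠ lead i) :
    ∃ w ∈ (gadgetGraph I side A n).delete Set.univ u,
      GadgetVertex.color side w = (GadgetVertex.color side u).opp ∧
      ∃ t, (gadgetGraph I side A n).delete ((gadgetGraph I side A n).delete Set.univ u) w =
        Set.range (pile (GadgetVertex.color side u).opp t) := by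
  have hdel (w : GadgetVertex I A n) (S : Set (GadgetVertex I A n)) (hS : S =
      {v | (v ≠ u ∧ ¬ GadgetVertex.Adj u v) ∧ v ≠ w ∧ ¬ GadgetVertex.Adj w v}) :
      (gadgetGraph I side A n).delete ((gadgetGraph I side A n).delete Set.univ u) w = S := by
    rw [hS]
    ext v
    change ((True ∧ _ ∧ _) ∧ _ ∧ _) ↔ _
    rw [true_and]
    rfl
  have hmem (w : GadgetVertex I A n) (h1 : w ≠ u) (h2 : ¬ GadgetVertex.Adj u w) :
    w ∈ (gadgetGraph I side A n).delete Set.univ u := ⟨trivial, h1, h2⟩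
  cases u with
  | lead i => exact absurd rfl (hu i)
  | opt i x =>
    obtain ⟨c, hc⟩ : ∃ c, (A i).color x = c := ⟨_, rfl⟩
    -- The move has deleted all keys and piles of its own color, so either opposing key would do;
    -- `false` is an arbitrary choice.
    refine ⟨key c.opp false, hmem _ (by simp) ?_, by simp [GadgetVertex.color, hc], false,
      hdel _ _ ?_⟩
    · simpa [GadgetVertex.Adj, hc] using c.opp_ne.symm
    · ext v
      cases v <;> simp [GadgetVertex.Adj, GadgetVertex.color, hc]
      all_goals cases c <;> simp [Color.opp, partner] <;> grind [Color]
  | key c t =>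
    -- The first key leaves its own pile, this one opposing key and that key's pile. Composing the
    -- two partner maps negates the index, so the answering key spares the other pile of color `c`,
    -- already gone, and deletes the pile of index `t`.
    refine ⟨key c.opp (partner c t), hmem _ ?_ ?_, rfl, partner c t, hdel _ _ ?_⟩
    · cases c <;> simp [Color.opp]
    · simp [GadgetVertex.Adj]
    · ext v
      cases v <;> simp [GadgetVertex.Adj, GadgetVertex.color]
      all_goals cases c <;> cases t <;> simp [Color.opp, partner] <;> grind [Color]
  | pile c t k =>
    -- Each partner map is an involution, so this key spares, among the piles of color `c`, exactly
    -- the one of index `!t`, which the opening move has deleted.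
    refine ⟨key c.opp (partner c.opp (!t)), hmem _ (by simp) ?_, rfl, partner c.opp (!t), hdel _ _ ?_⟩
    · simpa [GadgetVertex.Adj] using c.opp_ne
    · ext v
      cases v <;> simp [GadgetVertex.Adj, GadgetVertex.color]
      all_goals cases c <;> cases t <;> simp [Color.opp, partner] <;> grind [Color]

end gadgetGraph

-- Value of the gadget digraph

namespace gadgetGraph

open GadgetVertex

variable {I : Type} [Finite I] {side : I → Color} {A : I → DigraphPlacement} {n : ℕ}

theorem not_adj_of_mem_range_pile {c : Color} {t : Bool} {u v : GadgetVertex I A n}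
    (hu : u ∈ Set.range (pile c t)) (hv : v ∈ Set.range (pile c t)) :
    ¬ (gadgetGraph I side A n).graph.Adj u v := by
  obtain ⟨k, rfl⟩ := hu
  obtain ⟨l, rfl⟩ := hv
  change ¬ (c = c ∧ t = !t)
  cases t <;> simp

theorem le_position_pile {X : ShortGame} (hX : X.birthday ≤ n) (t : Bool) :
    X ≤ (gadgetGraph I side A n).position (Set.range (pile .blue t)) := by
  refine DigraphPlacement.le_position_of_blue n X _ hX (ncard_range_pile _ t).ge ?_
    fun u hu v hv => not_adj_of_mem_range_pile hu hv
  rintro _ ⟨k, rfl⟩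
  rfl

theorem position_pile_le {X : ShortGame} (hX : X.birthday ≤ n) (t : Bool) :
    (gadgetGraph I side A n).position (Set.range (pile .red t)) ≤ X := by
  refine DigraphPlacement.position_le_of_red n X _ hX (ncard_range_pile _ t).ge ?_
    fun u hu v hv => not_adj_of_mem_range_pile hu hv
  rintro _ ⟨k, rfl⟩
  rfl

/-- The digraph built from realizations of the undominated options of a game realizes the game. -/
theorem value_eq {X : ShortGame} (hX : X.birthday ≤ n)
    (hL : ∀ i, side i = .blue → (A i).value ∈ Value.leftValues X)
    (hR : ∀ i, side i = .red → (A i).value ∈ Value.rightValues X)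
    (hL' : ∀ x ∈ Value.leftValues X, ∃ i, side i = .blue ∧ x ≤ (A i).value)
    (hR' : ∀ x ∈ Value.rightValues X, ∃ i, side i = .red ∧ (A i).value ≤ x) :
    (gadgetGraph I side A n).value = Quotient.mk _ X := by
  refine Value.mk_eq_mk.2 ⟨ShortGame.le_of_options (fun Z hZ => ?_) (fun Z hZ => .inl ?_),
    ShortGame.le_of_options (fun Z hZ => .inl ?_) (fun Z hZ => ?_)⟩
  · obtain ⟨u, -, hu, rfl⟩ := DigraphPlacement.leftOpt_position.1 hZ
    by_cases h : ∃ i, u = lead i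
    · obtain ⟨i, rfl⟩ := h
      obtain ⟨W, hW, e⟩ := hL i hu
      exact .inl ⟨W, hW, ShortGame.le_trans (position_lead i).1 (Value.mk_eq_mk.1 e).2⟩
    -- A move off the leads is reversed: Right answers to a red pile, which is at most `X` because
    -- `n` bounds the birthday.
    · obtain ⟨w, hw, hc, t, ht⟩ := exists_answer (side := side) u (not_exists.1 h)
      rw [show GadgetVertex.color side u = .blue from hu] at hc ht
      refine .inr ⟨_, DigraphPlacement.rightOpt_position.2 ⟨w, hw, hc, rfl⟩, ?_⟩
      rw [ht]
      exact position_pile_le hX t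
  · obtain ⟨i, hi, hle⟩ := hR' _ ⟨Z, hZ, rfl⟩
    exact ⟨_, DigraphPlacement.rightOpt_position.2 ⟨lead i, trivial, hi, rfl⟩,
      ShortGame.le_trans (position_lead i).1 hle⟩
  · obtain ⟨i, hi, hle⟩ := hL' _ ⟨Z, hZ, rfl⟩
    exact ⟨_, DigraphPlacement.leftOpt_position.2 ⟨lead i, trivial, hi, rfl⟩,
      ShortGame.le_trans hle (position_lead i).2⟩
  · obtain ⟨u, -, hu, rfl⟩ := DigraphPlacement.rightOpt_position.1 hZ
    by_cases h : ∃ i, u = lead i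
    · obtain ⟨i, rfl⟩ := h
      obtain ⟨W, hW, e⟩ := hR i hu
      exact .inl ⟨W, hW, ShortGame.le_trans (Value.mk_eq_mk.1 e).1 (position_lead i).2⟩
    · obtain ⟨w, hw, hc, t, ht⟩ := exists_answer (side := side) u (not_exists.1 h)
      rw [show GadgetVertex.color side u = .red from hu] at hc ht
      refine .inr ⟨_, DigraphPlacement.leftOpt_position.2 ⟨w, hw, hc, rfl⟩, ?_⟩
      rw [ht]
      exact le_position_pile hX t

end gadgetGraph

-- Realizing values and counting vertices

/-- Undominated sets of Left and Right option values, with realizations of their elements, give a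
realization of the game. -/
theorem exists_digraph {X : ShortGame} {n k : ℕ} (hX : X.birthday ≤ n) {S T : Finset Value}
    (hS : (S : Set Value) ⊆ Value.leftValues X) (hT : (T : Set Value) ⊆ Value.rightValues X)
    (hS' : ∀ x ∈ Value.leftValues X, ∃ y ∈ S, x ≤ y)
    (hT' : ∀ x ∈ Value.rightValues X, ∃ y ∈ T, y ≤ x)
    (hk : ∀ x, x ∈ S ∨ x ∈ T → ∃ G : DigraphPlacement, G.value = x ∧ G.order ≤ k) :
    ∃ G : DigraphPlacement, G.value = Quotient.mk _ X ∧
      G.order ≤ (S.card + T.card) * (k + 1) + (4 + 4 * n) := by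
  choose A hA hAk using fun i : S => hk i (.inl i.2)
  choose B hB hBk using fun j : T => hk j (.inr j.2)
  -- Values live in `Type 1` but vertices in `Type`, so the options are reindexed by `Fin`.
  let C : Fin S.card ⊕ Fin T.card → DigraphPlacement :=
    Sum.elim (fun i => A (S.equivFin.symm i)) (fun j => B (T.equivFin.symm j))
  refine ⟨gadgetGraph _ (Sum.elim (fun _ => .blue) (fun _ => .red)) C n,
    gadgetGraph.value_eq hX ?_ ?_ ?_ ?_, ?_⟩
  · rintro (i | j) h
    · exact (hA _).symm ▸ hS (S.equivFin.symm i).2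
    · exact Color.noConfusion h
  · rintro (i | j) h
    · exact Color.noConfusion h
    · exact (hB _).symm ▸ hT (T.equivFin.symm j).2
  · intro x hx
    obtain ⟨y, hy, hle⟩ := hS' x hx
    refine ⟨.inl (S.equivFin ⟨y, hy⟩), rfl, ?_⟩
    simpa [C, hA] using hle
  · intro x hx
    obtain ⟨y, hy, hle⟩ := hT' x hx
    refine ⟨.inr (T.equivFin ⟨y, hy⟩), rfl, ?_⟩
    simpa [C, hB] using hle
  · have hC (i) : Nat.card (C i).V ≤ k := by
      rcases i with i | j
      · exact hAk _
      · exact hBk _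
    have hsum : Nat.card (Σ i, (C i).V) ≤ (S.card + T.card) * k := by
      rw [Nat.card_sigma]
      refine (Finset.sum_le_card_nsmul _ _ k fun i _ => hC i).trans ?_
      simp
    have hI : Nat.card (Fin S.card ⊕ Fin T.card) = S.card + T.card := by simp
    change Nat.card (GadgetVertex _ C n) ≤ _
    rw [GadgetVertex.card_eq, hI, mul_add, mul_one]
    omega

/-- Induction on the birthday, feeding all options into the gadget; domination matters only for the
size. -/
theorem exists_digraph_value_eq (X : ShortGame) :
    ∃ G : DigraphPlacement, G.value = Quotient.mk _ X := by
  induction h : X.birthday using Nat.strong_induction_on generalizing X with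
  | _ n ih =>
    have hopt (x : Value) (hx : x ∈ Value.leftValues X ∨ x ∈ Value.rightValues X) :
        ∃ G : DigraphPlacement, G.value = x := by
      rcases hx with ⟨Z, hZ, rfl⟩ | ⟨Z, hZ, rfl⟩
      · exact ih _ (h ▸ hZ.birthday_lt) Z rfl
      · exact ih _ (h ▸ hZ.birthday_lt) Z rfl
    have hfin := (Value.finite_leftValues X).union (Value.finite_rightValues X)
    have : Nonempty DigraphPlacement := ⟨{ V := Empty, graph := ⊥, color := Empty.elim }⟩
    choose! G hG using hopt
    -- Any common bound on the orders works, since the resulting size is discarded.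
    obtain ⟨k, hk⟩ := (hfin.image fun x => (G x).order).bddAbove
    obtain ⟨H, hH, -⟩ := exists_digraph (X := X) (k := k) le_rfl
      (S := (Value.finite_leftValues X).toFinset) (T := (Value.finite_rightValues X).toFinset)
      (by simp) (by simp) (fun x hx => ⟨x, by simpa using hx, le_rfl⟩)
      (fun x hx => ⟨x, by simpa using hx, le_rfl⟩) (fun x hx => by
        simp only [Set.Finite.mem_toFinset] at hx
        exact ⟨G x, hG x hx, hk ⟨x, hx, rfl⟩⟩)
    exact ⟨H, hH⟩

-- Attained extrema and the recursive bound

/-- Realizability rules out the default `sInf ∅ = 0`. -/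
theorem isLeast_minVertices (x : Value) : IsLeast (vertexCounts x) (minVertices x) := by
  obtain ⟨G, hG⟩ := exists_digraph_value_eq x.out
  rw [Value.mk_out] at hG
  exact ⟨Nat.sInf_mem ⟨_, G, hG, rfl⟩, fun _ h => Nat.sInf_le h⟩

theorem isGreatest_maxMinVertices (b : ℕ) :
    IsGreatest (minVertices '' Value.bornBy b) (maxMinVertices b) := by
  have hb := ((Value.finite_bornBy b).image minVertices).bddAbove
  exact ⟨Nat.sSup_mem ((Value.bornBy_nonempty b).image _) hb, fun _ h => le_csSup hb h⟩

theorem isGreatest_maxAntichain (b : ℕ) :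
    IsGreatest (antichainSizes b) (maxAntichain b) := by
  have hb : BddAbove (antichainSizes b) := by
    refine ⟨(Value.bornBy b).ncard, ?_⟩
    rintro _ ⟨S, hS, -, rfl⟩
    rw [← Set.ncard_coe_finset]
    exact Set.ncard_le_ncard hS (Value.finite_bornBy b)
  exact ⟨Nat.sSup_mem ⟨0, ∅, by simp, by simp, rfl⟩ hb, fun _ h => le_csSup hb h⟩

/-- A finite set of values has an antichain of upper bounds. -/
theorem exists_antichain_ge {s : Set Value} (hs : s.Finite) :
    ∃ S : Finset Value, (S : Set Value) ⊆ s ∧ IsAntichain (· ≤ ·) (S : Set Value) ∧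
      ∀ x ∈ s, ∃ y ∈ S, x ≤ y := by
  have hfin : {x | Maximal (· ∈ s) x}.Finite := hs.subset fun x hx => hx.prop
  refine ⟨hfin.toFinset, ?_, ?_, fun x hx => ?_⟩
  · rw [hfin.coe_toFinset]
    exact fun x hx => hx.prop
  · rw [hfin.coe_toFinset]
    exact setOfPred_maximal_antichain _
  · obtain ⟨y, hxy, hy⟩ := hs.exists_le_maximal hx
    exact ⟨y, hfin.mem_toFinset.2 (Set.mem_ofPred.2 hy), hxy⟩

/-- A finite set of values has an antichain of lower bounds. -/
theorem exists_antichain_le {s : Set Value} (hs : s.Finite) :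
    ∃ S : Finset Value, (S : Set Value) ⊆ s ∧ IsAntichain (· ≤ ·) (S : Set Value) ∧
      ∀ x ∈ s, ∃ y ∈ S, y ≤ x := by
  have hfin : {x | Minimal (· ∈ s) x}.Finite := hs.subset fun x hx => hx.prop
  refine ⟨hfin.toFinset, ?_, ?_, fun x hx => ?_⟩
  · rw [hfin.coe_toFinset]
    exact fun x hx => hx.prop
  · rw [hfin.coe_toFinset]
    exact setOfPred_minimal_antichain _
  · obtain ⟨y, hxy, hy⟩ := hs.exists_le_minimal hx
    exact ⟨y, hfin.mem_toFinset.2 (Set.mem_ofPred.2 hy), hxy⟩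

/-- The additive term counts four keys and four piles of `b + 1` vertices; the `+ 1` in the factor
counts the lead of each option. -/
theorem minVertices_le {b : ℕ} {x : Value} (hx : x ∈ Value.bornBy (b + 1)) :
    minVertices x ≤ 2 * maxAntichain b * (maxMinVertices b + 1) + (4 + 4 * (b + 1)) := by
  obtain ⟨X, hX, rfl⟩ := hx
  have hLb := Value.leftValues_subset hX
  have hRb := Value.rightValues_subset hX
  obtain ⟨S, hS, hSa, hS'⟩ := exists_antichain_ge (Value.finite_leftValues X)
  obtain ⟨T, hT, hTa, hT'⟩ := exists_antichain_le (Value.finite_rightValues X)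
  obtain ⟨G, hG, hle⟩ := exists_digraph (k := maxMinVertices b) hX hS hT hS' hT' fun x hx => by
    obtain ⟨G, hG, ho⟩ := (isLeast_minVertices x).1
    refine ⟨G, hG, ho.trans_le ((isGreatest_maxMinVertices b).2 ⟨x, ?_, rfl⟩)⟩
    exact hx.elim (fun h => hLb (hS h)) (fun h => hRb (hT h))
  have h1 : S.card ≤ maxAntichain b :=
    (isGreatest_maxAntichain b).2 ⟨S, hS.trans hLb, hSa, rfl⟩
  have h2 : T.card ≤ maxAntichain b :=
    (isGreatest_maxAntichain b).2 ⟨T, hT.trans hRb, hTa, rfl⟩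
  refine ((isLeast_minVertices _).2 ⟨G, hG, rfl⟩).trans (hle.trans ?_)
  gcongr
  omega

end DiPlace

theorem mainTheorem5 (b : ℕ) :
    (∀ x ∈ DiPlace.Value.bornBy (b + 1),
      IsLeast (DiPlace.vertexCounts x) (DiPlace.minVertices x)) ∧
    IsGreatest (DiPlace.minVertices '' DiPlace.Value.bornBy (b + 1))
      (DiPlace.maxMinVertices (b + 1)) ∧
    IsGreatest (DiPlace.minVertices '' DiPlace.Value.bornBy b) (DiPlace.maxMinVertices b) ∧
    IsGreatest (DiPlace.antichainSizes b) (DiPlace.maxAntichain b) ∧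
    DiPlace.maxMinVertices (b + 1) ≤
      2 * DiPlace.maxAntichain b * (DiPlace.maxMinVertices b + b + 1) + 5 * b + 8 := by
  refine ⟨fun x _ => DiPlace.isLeast_minVertices x, DiPlace.isGreatest_maxMinVertices _,
    DiPlace.isGreatest_maxMinVertices b, DiPlace.isGreatest_maxAntichain b, ?_⟩
  obtain ⟨x, hx, h⟩ := (DiPlace.isGreatest_maxMinVertices (b + 1)).1
  have h1 := DiPlace.minVertices_le hx
  -- The construction beats the claimed bound by `2 a(b) b + b`.
  have h2 : 2 * DiPlace.maxAntichain b * (DiPlace.maxMinVertices b + 1) ≤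
      2 * DiPlace.maxAntichain b * (DiPlace.maxMinVertices b + b + 1) := by
    gcongr
    omega
  omega
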